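/- Let $\mathbb{Q}\subseteq k\subseteq l$ be number fields such that $l/\mathbb{Q}$ and $k/\mathbb{Q}$ are finite Galois extensions and $1\le r(k)<r(l)$, where $r(\cdot)$ denotes the rank of the unit group. Notation. For a number field $m$ with ring of integers $O_m$, write $F_m=O_m^\times/\mathrm{Tor}(O_m^\times)$. Put $G=\mathrm{Aut}(l/\mathbb{Q})$, which acts on $F_l$, and $H=\mathrm{Aut}(l/k)$, a normal subgroup of $G$. Let $E_{l/k}=\ker(\mathrm{norm}_{l/k}:F_l\to F_k)$ be the group of relative units, where $\mathrm{norm}_{l/k}$ is induced by the field norm. For a place $w$ of $l$ let $\|\cdot\|_w$ extend the usual absolute value of $\mathbb{Q}$ and let $|\cdot|_w=\|\cdot\|_w^{d_w/d}$, where $d_w$ is the local degree of $w$ over $\mathbb{Q}$ and $d=[l:\mathbb{Q}]$. Let $h(\alpha)=\sum_w\log^+|\alpha|_w$ (sum over all places $w$ of $l$) be the absolute logarithmic Weil height, which is well defined on $F_l$. The group $G$ acts on the places of $l$ by $\|\gamma\|_{\sigma w}=\|\sigma^{-1}(\gamma)\|_w$. Fix an archimedean place $\widehat w$ of $l$ with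 stabilizer $K=G_{\widehat w}\subseteq G$, and set $N=[G:K]$, $I=[G:HK]$, $J=[HK:K]$. An element $\beta\in F_l$ is a *special Minkowski unit with respect to $\widehat w$* if $\log|\beta|_w<0$ for every archimedean place $w\ne\widehat w$ of $l$. Let $\{\psi_1,\dots,\psi_N\}$ be a transversal for the left cosets of $K$ in $G$ and, for $\alpha\in F_l$ and $f:G\to\mathbb{Z}$ constant on left cosets of $K$, put $$\Delta(\alpha,f)=\prod_{n=1}^N\psi_n(\alpha)^{f(\psi_n)}\in F_l .$$ Let $\lambda:G\to\mathbb{Z}$ be $\lambda(g)=J-1$ if $g\in K$, $\lambda(g)=-1$ if $g\in HK\setminus K$, and $\lambda(g)=0$ if $g\in G\setminus HK$. Let $\{\tau_1,\dots,\tau_I\}$ be a transversal for the left cosets of $HK$ in $G$, let $\{\sigma_1,\dots,\sigma_J\}$ be a transversal for the left cosets of $K$ in $HK$, and for each $i=1,\dots,I$ let $\mathcal J_i\subseteq\{1,\dots,J\}$ be any subset with $|\mathcal J_i|=J-1$. Theorem. Let $\beta\in F_l$ be a special Minkowski unit with respect to $\widehat w$. (i) If $l$ is totally real, then the elements $\tau_i\sigma_j\bigl(\Delta(\beta,\lambda)\bigr)$,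 $1\le i\le I$, $j\in\mathcal J_i$, belong to $E_{l/k}$ and are multiplicatively independent (as an indexed family), and $$h\bigl(\Delta(\beta,\lambda)\bigr)\le 2([l:k]-1)\,h(\beta).$$ (ii) If $l$ is totally complex, so that $K=\{1,\rho\}$ with $\rho$ of order $2$, then the elements $\tau_i\sigma_j\bigl(\Delta(\beta\rho(\beta),\lambda)\bigr)$, $1\le i\le I$, $j\in\mathcal J_i$, belong to $E_{l/k}$ and are multiplicatively independent (as an indexed family), and $$h\bigl(\Delta(\beta\rho(\beta),\lambda)\bigr)\le 4([l:k]-1)\,h(\beta).$$ -/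

import Mathlib

set_option maxSynthPendingDepth 3

open NumberField

noncomputable section

namespace RelativeUnits

/-! ### Units modulo roots of unity -/

/-- `F_l`: the units of the ring of integers modulo the roots of unity. -/
abbrev FreeUnits (l : Type*) [Field l] [NumberField l] : Type _ :=
  (𝓞 l)ˣ ⧸ Units.torsion l

section
variable {l : Type*} [Field l] [NumberField l]

/-- An automorphism `σ` of `l` acts on `F_l` by `u · Tor ↦ σ(u) · Tor`. -/
def conj (σ : l ≃ₐ[ℚ] l) : FreeUnits l →* FreeUnits l :=
  QuotientGroup.map (Units.torsion l) (Units.torsion l)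
    (_root_.Units.map (RingOfIntegers.mapRingHom (σ : l →+* l) : 𝓞 l →* 𝓞 l))
    fun _ hu => MonoidHom.isOfFinOrder _ hu

/-- The normalised absolute value `|x|_w = ‖x‖_w ^ (d_w / d)` on units, where `d_w` is the local
degree of `w`, `d = [l : ℚ]`, and `‖ ‖_w` extends the usual absolute value of `ℚ`. -/
def unitAbs (w : InfinitePlace l) : (𝓞 l)ˣ →* ℝ where
  toFun u := w (u : l) ^ ((w.mult : ℝ) / (Module.finrank ℚ l : ℝ))
  map_one' := by simp
  map_mul' u v := by
    simp only [Units.coe_mul, map_mul]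
    exact Real.mul_rpow (apply_nonneg w _) (apply_nonneg w _)

/-- The normalised absolute value `| |_w` on `F_l`. -/
def absF (w : InfinitePlace l) : FreeUnits l →* ℝ :=
  QuotientGroup.lift (Units.torsion l) (unitAbs w) fun u hu => by
    have h := (Units.mem_torsion l).1 hu w
    simp [unitAbs, h]

/-- `β ∈ F_l` is a special Minkowski unit with respect to the archimedean place `ŵ`. -/
def IsSpecialMinkowskiUnit (ŵ : InfinitePlace l) (β : FreeUnits l) : Prop :=
  ∀ w : InfinitePlace l, w ≠ ŵ → Real.log (absF w β) < 0

/-- The absolute logarithmic Weil height of `x ∈ l`, i.e. the sum over all places of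
`log⁺ |x|_w`. Mathlib's `Height.logHeight₁` is the same sum formed with the absolute values
`‖ ‖_w ^ d_w`, hence the division by `[l : ℚ]`. -/
def weilHeight (x : l) : ℝ := Height.logHeight₁ x / (Module.finrank ℚ l : ℝ)

theorem weilHeight_mul_torsion (u ζ : (𝓞 l)ˣ) (hζ : ζ ∈ Units.torsion l) :
    weilHeight ((u * ζ : (𝓞 l)ˣ) : l) = weilHeight (u : l) := by
  have h1 : IsOfFinOrder (ζ : l) := by
    exact MonoidHom.isOfFinOrder
      ((algebraMap (𝓞 l) l : 𝓞 l →* l).comp (_root_.Units.coeHom (𝓞 l))) hζ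
  obtain ⟨n, hn, hpow⟩ := isOfFinOrder_iff_pow_eq_one.1 h1
  have key : ∀ f : AbsoluteValue l ℝ, f (ζ : l) = 1 := fun f => by
    have h2 : f (ζ : l) ^ n = 1 := by rw [← map_pow, hpow, map_one]
    exact (pow_eq_one_iff_of_nonneg (f.nonneg _) hn.ne').1 h2
  have hfin : ∀ v : FinitePlace l, v (ζ : l) = 1 := fun v => key v.1
  have hinf : ∀ v : InfinitePlace l, v (ζ : l) = 1 := fun v => key v.1
  unfold weilHeight
  simp only [NumberField.logHeight₁_eq, Units.coe_mul, map_mul, hfin, hinf, mul_one]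

/-- The Weil height on `F_l`, which is well defined because the height of a unit does not change
under multiplication by roots of unity. -/
def height : FreeUnits l → ℝ :=
  Quotient.lift (fun u : (𝓞 l)ˣ => weilHeight (u : l)) fun a b hab => by
    have h : a⁻¹ * b ∈ Units.torsion l := QuotientGroup.leftRel_apply.1 hab
    have := weilHeight_mul_torsion a (a⁻¹ * b) h
    rw [mul_inv_cancel_left] at this
    exact this.symm

/-- The product `Δ(α, f) = ∏ ψₙ(α) ^ f(ψₙ)`, where `ψ₁, …, ψ_N` is a transversal for the left
cosets of the stabiliser of an archimedean place. -/
def Delta {N : ℕ} (ψ : Fin N → (l ≃ₐ[ℚ] l)) (α : FreeUnits l) (f : (l ≃ₐ[ℚ] l) → ℤ) :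
    FreeUnits l :=
  ∏ n, conj (ψ n) α ^ f (ψ n)

/-! ### Relative units -/

/-- The homomorphism `F_l → F_k` induced by the norm from `l` to `k`. -/
def normF (k : IntermediateField ℚ l) : FreeUnits l →* FreeUnits k :=
  QuotientGroup.map (Units.torsion l) (Units.torsion k)
    (_root_.Units.map (RingOfIntegers.norm k : 𝓞 l →* 𝓞 k))
    fun _ hu => MonoidHom.isOfFinOrder _ hu

/-- `E_{l/k}`: the subgroup of relative units in `F_l`. -/
def relUnits (k : IntermediateField ℚ l) : Subgroup (FreeUnits l) := (normF k).ker

end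

/-! ### Transversals and the function `λ` on a finite group -/

section
variable {G : Type*} [Group G]

/-- `t₁, …, tₙ` is a system of representatives, without repetition, for the left cosets of `K`. -/
def IsLeftTransversal (K : Subgroup G) {n : ℕ} (t : Fin n → G) : Prop :=
  Function.Bijective fun i => (t i : G ⧸ K)

open Classical in
/-- The function `λ : G → ℤ` attached to a normal subgroup `H` and a subgroup `K`, with
`J = [HK : K]`: it is `J - 1` on `K`, `-1` on the rest of `HK`, and `0` outside `HK`. As `H` is
normal, the product set `HK` is the subgroup `H ⊔ K`. -/
def lam (H K : Subgroup G) (g : G) : ℤ :=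
  if g ∈ K then (K.relIndex (H ⊔ K) : ℤ) - 1
  else if g ∈ H ⊔ K then -1
  else 0

end

end RelativeUnits

end

namespace RelativeUnits

/-! ### Sums over finite groups -/

section
variable {G : Type*} [Group G]

/-! Write `M` for `HK`, `a x` for the logarithm of `α` at the place `x • ŵ`, and `D` for `Δ(α, λ)`,
where `α` is `β` or `β ρ(β)`; in both cases the logarithms of `α` are `K`-invariant. Since `λ =
J·1_K - 1_M`, up to the factor `|K|` passing from `α` to `D` applies `|M|·id - ∑_{m ∈ M} m` to the
logarithms (`card_mul_logAbs_Delta`). This operator kills sums over `H`-orbits of places, so the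
conjugates of `D` are relative units.

For independence, a relation among conjugates of `D` becomes a right `K`-invariant function `C` on
`G`. The operator can be moved from `a` to `C`, giving `B` with `∑ x, B x * a (x⁻¹ * g) = 0`. As `a`
is negative off `K` and has sum zero, a maximum principle (`eq_of_sum_mul_eq_zero`) makes `B`
constant. Its sum over a coset of `M` is zero, so `B = 0` and `C` is constant on cosets of `M`. Each
coset contains an omitted index, where `C = 0`.

The height is half the ℓ¹ norm of the logarithms, so `∑ |λ(ψₙ)| = 2(J - 1)` and `J ≤ |H| = [l : k]`
give the bound. -/

theorem bijective_mul_transversal {K : Subgroup G} {ι : Type*} {t : ι → G}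
    (ht : Function.Bijective fun i => (t i : G ⧸ K)) :
    Function.Bijective fun p : ι × K => t p.1 * (p.2 : G) := by
  constructor
  · rintro ⟨i, a⟩ ⟨j, b⟩ h
    have hij : i = j := ht.1 <| by
      have h' : t i * (a : G) = t j * (b : G) := h
      have : ((t i * (a : G) : G) : G ⧸ K) = ((t j * (b : G) : G) : G ⧸ K) := by rw [h']
      simpa using this
    subst hij
    simpa using h
  · intro x
    obtain ⟨i, hi⟩ := ht.2 (x : G ⧸ K)
    exact ⟨(i, ⟨(t i)⁻¹ * x, QuotientGroup.eq.1 hi⟩), by simp⟩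

theorem IsLeftTransversal.mul {K M : Subgroup G} (hKM : K ≤ M) {I J : ℕ} {τ : Fin I → G}
    (hτ : IsLeftTransversal M τ) {σ : Fin J → M} (hσ : IsLeftTransversal (K.subgroupOf M) σ) :
    Function.Bijective fun p : Fin I × Fin J => ((τ p.1 * (σ p.2 : G) : G) : G ⧸ K) := by
  constructor
  · rintro ⟨i, j⟩ ⟨i', j'⟩ h
    have h1 : (τ i * (σ j : G))⁻¹ * (τ i' * (σ j' : G)) ∈ K := QuotientGroup.eq.1 h
    have hi : i = i' := hτ.1 <| by
      refine QuotientGroup.eq.2 ?_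
      have := M.mul_mem (M.mul_mem (σ j).2 (hKM h1)) (M.inv_mem (σ j').2)
      simpa [mul_assoc] using this
    subst hi
    have hj : j = j' := hσ.1 <| by
      refine QuotientGroup.eq.2 (Subgroup.mem_subgroupOf.2 ?_)
      simpa [mul_assoc] using h1
    rw [hj]
  · intro q
    obtain ⟨x, rfl⟩ := QuotientGroup.mk_surjective q
    obtain ⟨i, hi⟩ := hτ.2 (x : G ⧸ M)
    have hm : (τ i)⁻¹ * x ∈ M := QuotientGroup.eq.1 hi
    obtain ⟨j, hj⟩ := hσ.2 ((⟨(τ i)⁻¹ * x, hm⟩ : M) : M ⧸ K.subgroupOf M)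
    refine ⟨(i, j), QuotientGroup.eq.2 ?_⟩
    have := Subgroup.mem_subgroupOf.1 (QuotientGroup.eq.1 hj)
    simpa [mul_assoc] using this

theorem lam_mul_of_mem (H K : Subgroup G) (x : G) {y : G} (hy : y ∈ K) :
    lam H K (x * y) = lam H K x := by
  have hy' : y ∈ H ⊔ K := Subgroup.mem_sup_right hy
  have h1 : x * y ∈ K ↔ x ∈ K := K.mul_mem_cancel_right hy
  have h2 : x * y ∈ H ⊔ K ↔ x ∈ H ⊔ K := (H ⊔ K).mul_mem_cancel_right hy'
  classical
  simp only [lam, h1, h2]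

variable [Fintype G]

theorem sum_eq_card_mul_sum_transversal {K : Subgroup G} [Fintype K] {ι : Type*} [Fintype ι]
    {t : ι → G} (ht : Function.Bijective fun i => (t i : G ⧸ K)) (f : G → ℝ)
    (hf : ∀ x, ∀ y ∈ K, f (x * y) = f x) :
    ∑ x, f x = Fintype.card K * ∑ i, f (t i) := by
  rw [← (bijective_mul_transversal ht).sum_comp f, Fintype.sum_prod_type, Finset.mul_sum]
  refine Finset.sum_congr rfl fun i _ => ?_
  simp [hf _ _ (Subtype.property _)]

/-- This is the identity `λ = J·1_K - 1_{HK}`, the only form in which `λ` is summed. -/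
theorem sum_lam_mul (H K : Subgroup G) [Fintype K] [Fintype ↥(H ⊔ K)] (F : G → ℝ) :
    ∑ x, (lam H K x : ℝ) * F x =
      (K.relIndex (H ⊔ K) : ℝ) * ∑ y : K, F y - ∑ y : ↥(H ⊔ K), F y := by
  classical
  have hsub (S : Subgroup G) [Fintype S] : ∑ y : S, F y = ∑ x, if x ∈ S then F x else 0 := by
    rw [← Finset.sum_filter]
    exact (Finset.sum_subtype _ (by simp) _).symm
  rw [hsub, hsub, Finset.mul_sum, ← Finset.sum_sub_distrib]
  refine Finset.sum_congr rfl fun x _ => ?_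
  by_cases hx : x ∈ K
  · have : x ∈ H ⊔ K := Subgroup.mem_sup_right hx
    simp [lam, hx, this, sub_mul]
  · by_cases hx' : x ∈ H ⊔ K <;> simp [lam, hx, hx']

/-- A matrix with negative entries off the diagonal blocks and vanishing row sums has only the
constant vectors in its kernel. -/
theorem eq_of_sum_mul_eq_zero {K : Subgroup G} {a : G → ℝ} (hneg : ∀ x ∉ K, a x < 0)
    (hsum : ∑ x, a x = 0) {B : G → ℝ} (hB : ∀ x, ∀ y ∈ K, B (x * y) = B x)
    (h : ∀ g, ∑ x, B x * a (x⁻¹ * g) = 0) (x y : G) : B x = B y := by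
  obtain ⟨g, hg⟩ := Finite.exists_max B
  have hs : ∑ x, a (x⁻¹ * g) = 0 := by
    rw [← hsum]
    exact ((Equiv.inv G).trans (Equiv.mulRight g)).sum_comp a
  have h0 : ∑ x, (B x - B g) * a (x⁻¹ * g) = 0 := by
    simp only [sub_mul, Finset.sum_sub_distrib, h g, ← Finset.mul_sum, hs, mul_zero, sub_zero]
  have hconst (x : G) (hx : x⁻¹ * g ∈ K) : B x = B g := by
    rw [← hB x _ hx, mul_inv_cancel_left]
  -- At a maximum `g` of `B`, both factors are nonpositive off `K`; a vanishing sum of nonnegative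
  -- terms has all terms zero.
  have hnn : ∀ x ∈ Finset.univ, 0 ≤ (B x - B g) * a (x⁻¹ * g) := fun x _ => by
    by_cases hx : x⁻¹ * g ∈ K
    · simp [hconst x hx]
    · exact mul_nonneg_of_nonpos_of_nonpos (sub_nonpos.2 (hg x)) (hneg _ hx).le
  have hz (x : G) : B x = B g := by
    by_cases hx : x⁻¹ * g ∈ K
    · exact hconst x hx
    · rcases mul_eq_zero.1 ((Finset.sum_eq_zero_iff_of_nonneg hnn).1 h0 x (Finset.mem_univ x))
        with h1 | h1
      · exact sub_eq_zero.1 h1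
      · exact absurd h1 (hneg _ hx).ne
  rw [hz x, hz y]

/-- Averaging over `M` can be transferred from `a` to `C`, after which the maximum principle applies
to the deviation `B` of `C` from its `M`-averages. -/
theorem mul_right_invariant_of_sum_eq_zero {K M : Subgroup G} (hKM : K ≤ M) [Fintype M]
    {a : G → ℝ} (hneg : ∀ x ∉ K, a x < 0) (hsum : ∑ x, a x = 0)
    {C : G → ℝ} (hC : ∀ x, ∀ y ∈ K, C (x * y) = C x)
    (h : ∀ g, ∑ x, C x *
      (Fintype.card M * a (x⁻¹ * g) - ∑ m : M, a ((m : G)⁻¹ * (x⁻¹ * g))) = 0)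
    (x : G) {y : G} (hy : y ∈ M) : C (x * y) = C x := by
  set B : G → ℝ := fun x => Fintype.card M * C x - ∑ m : M, C (x * m) with hBdef
  have hshift (x : G) (y : M) : ∑ m : M, C (x * y * m) = ∑ m : M, C (x * m) := by
    rw [← Equiv.sum_comp (Equiv.mulLeft y) fun m : M => C (x * m)]
    simp [mul_assoc]
  have hBK : ∀ x, ∀ y ∈ K, B (x * y) = B x := fun x y hy => by
    simp only [hBdef, hC x y hy, hshift x ⟨y, hKM hy⟩]
  have hBa (g : G) : ∑ x, B x * a (x⁻¹ * g) = 0 := by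
    rw [← h g]
    simp only [hBdef, sub_mul, mul_sub, Finset.sum_sub_distrib, Finset.sum_mul, Finset.mul_sum]
    congr 1
    · exact Finset.sum_congr rfl fun x _ => by ring
    · rw [Finset.sum_comm, Finset.sum_comm (s := Finset.univ) (t := Finset.univ)
        (f := fun x (m : M) => C x * a ((m : G)⁻¹ * (x⁻¹ * g)))]
      -- The substitutions `m ↦ m⁻¹`, then `x ↦ x * m`, move `m` from the argument of `a` to that of
      -- `C`.
      rw [← Equiv.sum_comp (Equiv.inv M) fun m : M => ∑ x, C x * a ((m : G)⁻¹ * (x⁻¹ * g))]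
      refine Finset.sum_congr rfl fun m _ => ?_
      rw [← Equiv.sum_comp (Equiv.mulRight (m : G))
        fun x => C x * a (((Equiv.inv M m : M) : G)⁻¹ * (x⁻¹ * g))]
      simp [mul_assoc]
  have hBconst := eq_of_sum_mul_eq_zero hneg hsum hBK hBa
  have hpos : (0 : ℝ) < Fintype.card M := by exact_mod_cast Fintype.card_pos
  have hB0 (x : G) : B x = 0 := by
    have h1 : ∑ m : M, B (x * m) = 0 := by
      simp only [hBdef, Finset.sum_sub_distrib, hshift, ← Finset.mul_sum]
      simp
    have h2 : ∑ m : M, B (x * m) = Fintype.card M * B x := by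
      simp [hBconst _ x]
    exact (mul_eq_zero.1 (h2.symm.trans h1)).resolve_left hpos.ne'
  have e1 := hB0 (x * y)
  have e2 := hB0 x
  simp only [hBdef, hshift x ⟨y, hy⟩] at e1 e2
  have : (Fintype.card M : ℝ) * C (x * y) = Fintype.card M * C x := by linarith
  exact mul_left_cancel₀ hpos.ne' this

end
end RelativeUnits

namespace RelativeUnits

/-! ### The logarithmic absolute values on `F_l` -/

section
variable {l : Type*} [Field l]

theorem place_unit_pos (w : InfinitePlace l) (u : (𝓞 l)ˣ) : 0 < w (u : l) :=
  InfinitePlace.pos_iff.2 (NumberField.Units.coe_ne_zero u)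

theorem infinitePlace_mult_smul [CharZero l] (σ : l ≃ₐ[ℚ] l) (w : InfinitePlace l) : (σ • w).mult = w.mult := by
  classical
  simp only [InfinitePlace.mult, InfinitePlace.isReal_smul_iff]

variable [NumberField l]

theorem absF_mk (w : InfinitePlace l) (u : (𝓞 l)ˣ) :
    absF w (u : FreeUnits l) = w (u : l) ^ ((w.mult : ℝ) / (Module.finrank ℚ l : ℝ)) := rfl

theorem conj_mk (σ : l ≃ₐ[ℚ] l) (u : (𝓞 l)ˣ) :
    conj σ (u : FreeUnits l) = ((_root_.Units.map
      (RingOfIntegers.mapRingHom (σ : l →+* l) : 𝓞 l →* 𝓞 l) u : (𝓞 l)ˣ) : FreeUnits l) := rfl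

theorem absF_pos (w : InfinitePlace l) (u : FreeUnits l) : 0 < absF w u := by
  obtain ⟨u, rfl⟩ := QuotientGroup.mk_surjective u
  exact Real.rpow_pos_of_pos (place_unit_pos w u) _

/-- The additive homomorphism `u ↦ log |u|_w` on `F_l`. -/
noncomputable def logAbs (w : InfinitePlace l) : Additive (FreeUnits l) →+ ℝ where
  toFun u := Real.log (absF w u.toMul)
  map_zero' := by simp
  map_add' u v := by
    rw [toMul_add, map_mul, Real.log_mul (absF_pos w _).ne' (absF_pos w _).ne']

theorem logAbs_ofMul (w : InfinitePlace l) (u : FreeUnits l) :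
    logAbs w (Additive.ofMul u) = Real.log (absF w u) := rfl

theorem logAbs_mk (w : InfinitePlace l) (u : (𝓞 l)ˣ) :
    logAbs w (Additive.ofMul (u : FreeUnits l)) =
      (w.mult : ℝ) / (Module.finrank ℚ l : ℝ) * Real.log (w (u : l)) := by
  rw [logAbs_ofMul, absF_mk, Real.log_rpow (place_unit_pos w u)]

theorem logAbs_conj (w : InfinitePlace l) (σ : l ≃ₐ[ℚ] l) (u : FreeUnits l) :
    logAbs w (Additive.ofMul (conj σ u)) = logAbs (σ⁻¹ • w) (Additive.ofMul u) := by
  obtain ⟨u, rfl⟩ := QuotientGroup.mk_surjective u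
  rw [conj_mk, logAbs_mk, logAbs_mk, infinitePlace_mult_smul]
  rfl

theorem logAbs_mul (w : InfinitePlace l) (u v : FreeUnits l) :
    logAbs w (Additive.ofMul (u * v)) =
      logAbs w (Additive.ofMul u) + logAbs w (Additive.ofMul v) := by
  rw [ofMul_mul, map_add]

theorem sum_logAbs (u : FreeUnits l) : ∑ w, logAbs w (Additive.ofMul u) = 0 := by
  obtain ⟨u, rfl⟩ := QuotientGroup.mk_surjective u
  have h := NumberField.Units.sum_mult_mul_log u
  simp only [logAbs_mk, div_mul_eq_mul_div, ← Finset.sum_div]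
  rw [h, zero_div]

theorem logAbs_Delta {N : ℕ} (ψ : Fin N → (l ≃ₐ[ℚ] l)) (α : FreeUnits l)
    (f : (l ≃ₐ[ℚ] l) → ℤ) (w : InfinitePlace l) :
    logAbs w (Additive.ofMul (Delta ψ α f)) =
      ∑ n, (f (ψ n) : ℝ) * logAbs ((ψ n)⁻¹ • w) (Additive.ofMul α) := by
  rw [Delta, ofMul_prod, map_sum]
  simp only [ofMul_zpow, map_zsmul, zsmul_eq_mul, logAbs_conj]

/-! ### Heights -/

theorem finitePlace_unit_le_one (v : FinitePlace l) (u : (𝓞 l)ˣ) : v (u : l) ≤ 1 := by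
  rw [← FinitePlace.norm_embedding_eq v (u : l)]
  exact FinitePlace.norm_le_one l v.maximalIdeal (u : 𝓞 l)

theorem height_eq_sum_posLog (u : FreeUnits l) :
    height u = ∑ w : InfinitePlace l, max 0 (logAbs w (Additive.ofMul u)) := by
  obtain ⟨u, rfl⟩ := QuotientGroup.mk_surjective u
  change Height.logHeight₁ (u : l) / (Module.finrank ℚ l : ℝ) = _
  have hfin (v : FinitePlace l) : Real.posLog (v (u : l)) = 0 := by
    rw [Real.posLog_eq_zero_iff, abs_of_nonneg (apply_nonneg v _)]
    exact finitePlace_unit_le_one v u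
  rw [NumberField.logHeight₁_eq, finsum_congr hfin, finsum_zero, add_zero, Finset.sum_div]
  refine Finset.sum_congr rfl fun w _ => ?_
  rw [logAbs_mk, Real.posLog, mul_div_right_comm, mul_max_of_nonneg _ _ (by positivity), mul_zero]

/-- By the product formula the positive and negative parts of the logarithms have equal total. -/
theorem two_mul_height (u : FreeUnits l) :
    2 * height u = ∑ w : InfinitePlace l, |logAbs w (Additive.ofMul u)| := by
  have h (x : ℝ) : |x| = 2 * max 0 x - x := by
    rcases le_total 0 x with hx | hx
    · rw [abs_of_nonneg hx, max_eq_right hx]; ring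
    · rw [abs_of_nonpos hx, max_eq_left hx]; ring
  simp only [h, Finset.sum_sub_distrib, ← Finset.mul_sum, sum_logAbs, sub_zero,
    height_eq_sum_posLog]

theorem height_nonneg (u : FreeUnits l) : 0 ≤ height u := by
  rw [height_eq_sum_posLog]
  exact Finset.sum_nonneg fun w _ => le_max_left _ _

theorem height_mul_le (u v : FreeUnits l) : height (u * v) ≤ height u + height v := by
  have : 2 * height (u * v) ≤ 2 * height u + 2 * height v := by
    simp only [two_mul_height, ← Finset.sum_add_distrib, logAbs_mul]
    exact Finset.sum_le_sum fun w _ => abs_add_le _ _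
  linarith

theorem height_conj (σ : l ≃ₐ[ℚ] l) (u : FreeUnits l) : height (conj σ u) = height u := by
  simp only [height_eq_sum_posLog, logAbs_conj]
  exact Equiv.sum_comp (MulAction.toPerm σ⁻¹)
    fun w : InfinitePlace l => max 0 (logAbs w (Additive.ofMul u))

theorem height_Delta_le {N : ℕ} (ψ : Fin N → (l ≃ₐ[ℚ] l)) (α : FreeUnits l)
    (f : (l ≃ₐ[ℚ] l) → ℤ) :
    height (Delta ψ α f) ≤ (∑ n, |(f (ψ n) : ℝ)|) * height α := by
  have h : 2 * height (Delta ψ α f) ≤ (∑ n, |(f (ψ n) : ℝ)|) * (2 * height α) := by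
    rw [two_mul_height, Finset.sum_mul]
    calc ∑ w, |logAbs w (Additive.ofMul (Delta ψ α f))|
        ≤ ∑ w : InfinitePlace l, ∑ n,
            |(f (ψ n) : ℝ)| * |logAbs ((ψ n)⁻¹ • w) (Additive.ofMul α)| := by
          refine Finset.sum_le_sum fun w _ => ?_
          rw [logAbs_Delta]
          refine (Finset.abs_sum_le_sum_abs _ _).trans_eq ?_
          simp only [abs_mul]
      _ = ∑ n, |(f (ψ n) : ℝ)| * (2 * height α) := by
          rw [Finset.sum_comm]
          refine Finset.sum_congr rfl fun n _ => ?_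
          rw [← Finset.mul_sum, two_mul_height]
          congr 1
          exact Equiv.sum_comp (MulAction.toPerm (ψ n)⁻¹)
            fun w : InfinitePlace l => |logAbs w (Additive.ofMul α)|
  linarith

/-! ### Relative units -/

/-- The sum is, up to a nonzero factor, the logarithm of the norm at the place below `w`; a unit
with all archimedean absolute values 1 is a root of unity. -/
theorem mem_relUnits_of_sum_eq_zero (k : IntermediateField ℚ l) [IsGalois k l]
    [Fintype k.fixingSubgroup] {u : FreeUnits l}
    (h : ∀ w : InfinitePlace l,
      ∑ σ : k.fixingSubgroup, logAbs ((σ : l ≃ₐ[ℚ] l) • w) (Additive.ofMul u) = 0) :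
    u ∈ relUnits k := by
  obtain ⟨u, rfl⟩ := QuotientGroup.mk_surjective u
  refine MonoidHom.mem_ker.2 ((QuotientGroup.eq_one_iff _).2 ?_)
  rw [NumberField.Units.mem_torsion]
  intro v
  obtain ⟨w, rfl⟩ := InfinitePlace.comap_surjective (K := l) v
  have hval : w.comap (algebraMap k l) (Algebra.norm k (u : l)) =
      ∏ σ : k.fixingSubgroup, ((σ : l ≃ₐ[ℚ] l) • w) (u : l) := by
    rw [InfinitePlace.comap_apply, Algebra.norm_eq_prod_automorphisms, map_prod]
    exact (Equiv.prod_comp ((Equiv.inv _).trans (IntermediateField.fixingSubgroupEquiv k).toEquiv)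
      fun τ : l ≃ₐ[k] l => w (τ (u : l))).symm
  refine hval.trans ?_
  have hw := h w
  have hc : (w.mult : ℝ) / (Module.finrank ℚ l : ℝ) ≠ 0 := by
    have := InfinitePlace.mult_pos (w := w)
    have := Module.finrank_pos (R := ℚ) (M := l)
    positivity
  simp only [logAbs_mk, infinitePlace_mult_smul, ← Finset.mul_sum] at hw
  rw [← Real.log_prod (fun σ _ => (place_unit_pos _ u).ne')] at hw
  refine Real.eq_one_of_pos_of_log_eq_zero (Finset.prod_pos fun σ _ => place_unit_pos _ u) ?_
  exact (mul_eq_zero.1 hw).resolve_left hc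

end
end RelativeUnits

namespace RelativeUnits

/-! ### The relative units `Δ(α, λ)` -/

theorem relIndex_mul_card {G : Type*} [Group G] {K M : Subgroup G} (hKM : K ≤ M)
    [Fintype K] [Fintype M] : K.relIndex M * Fintype.card K = Fintype.card M := by
  rw [← Nat.card_eq_fintype_card, ← Nat.card_eq_fintype_card,
    ← Nat.card_congr (Subgroup.subgroupOfEquivOfLe hKM).toEquiv, mul_comm]
  exact (K.subgroupOf M).card_mul_index

/-- `H` maps onto the cosets of `K` in `HK`. -/
theorem relIndex_sup_le_card {G : Type*} [Group G] [Finite G] (H K : Subgroup G) [H.Normal] :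
    K.relIndex (H ⊔ K) ≤ Nat.card H := by
  let f : H → ↥(H ⊔ K) ⧸ K.subgroupOf (H ⊔ K) := fun h =>
    ((⟨h, Subgroup.mem_sup_left h.2⟩ : ↥(H ⊔ K)) : ↥(H ⊔ K) ⧸ K.subgroupOf (H ⊔ K))
  refine Nat.card_le_card_of_surjective f fun q => ?_
  obtain ⟨⟨m, hm⟩, rfl⟩ := QuotientGroup.mk_surjective q
  obtain ⟨h, hh, y, hy, rfl⟩ := Subgroup.mem_sup_of_normal_left.1 hm
  refine ⟨⟨h, hh⟩, QuotientGroup.eq.2 (Subgroup.mem_subgroupOf.2 ?_)⟩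
  simpa using hy

section
variable {l : Type*} [Field l] [NumberField l]

theorem card_mul_logAbs_Delta {K H : Subgroup (l ≃ₐ[ℚ] l)} [Fintype K] [Fintype ↥(H ⊔ K)]
    {N : ℕ} {ψ : Fin N → (l ≃ₐ[ℚ] l)} (hψ : IsLeftTransversal K ψ) {α : FreeUnits l}
    (hα : ∀ x ∈ K, ∀ w : InfinitePlace l,
      logAbs (x • w) (Additive.ofMul α) = logAbs w (Additive.ofMul α)) (w : InfinitePlace l) :
    Fintype.card K * logAbs w (Additive.ofMul (Delta ψ α (lam H K))) =
      Fintype.card ↥(H ⊔ K) * logAbs w (Additive.ofMul α) -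
        ∑ m : ↥(H ⊔ K), logAbs ((m : l ≃ₐ[ℚ] l)⁻¹ • w) (Additive.ofMul α) := by
  rw [logAbs_Delta, ← sum_eq_card_mul_sum_transversal hψ
    (fun x => (lam H K x : ℝ) * logAbs (x⁻¹ • w) (Additive.ofMul α)), sum_lam_mul H K
    (fun x => logAbs (x⁻¹ • w) (Additive.ofMul α))]
  · have h1 (y : K) : logAbs ((y : l ≃ₐ[ℚ] l)⁻¹ • w) (Additive.ofMul α) =
        logAbs w (Additive.ofMul α) := hα _ (K.inv_mem y.2) w
    simp only [h1, Finset.sum_const, Finset.card_univ, nsmul_eq_mul]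
    rw [← relIndex_mul_card (le_sup_right : K ≤ H ⊔ K)]
    push_cast
    ring
  · intro x y hy
    rw [lam_mul_of_mem H K x hy, mul_inv_rev, mul_smul, hα _ (K.inv_mem hy)]

theorem sum_abs_lam_transversal {G : Type*} [Group G] [Finite G] (H K : Subgroup G) {N : ℕ}
    {ψ : Fin N → G} (hψ : IsLeftTransversal K ψ) :
    ∑ n, |(lam H K (ψ n) : ℝ)| = 2 * ((K.relIndex (H ⊔ K) : ℝ) - 1) := by
  classical
  have := Fintype.ofFinite G
  have := Fintype.ofFinite K
  have := Fintype.ofFinite ↥(H ⊔ K)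
  have hK : (0 : ℝ) < Fintype.card K := by exact_mod_cast Fintype.card_pos
  have hr : (1 : ℝ) ≤ K.relIndex (H ⊔ K) := by
    exact_mod_cast Nat.one_le_iff_ne_zero.2 Subgroup.FiniteIndex.index_ne_zero
  have hcard := relIndex_mul_card (le_sup_right : K ≤ H ⊔ K)
  have habs (x : G) : |(lam H K x : ℝ)| = (lam H K x : ℝ) *
      (if x ∈ K then 1 else -1) := by
    by_cases hx : x ∈ K
    · simpa [lam, hx] using hr
    · by_cases hx' : x ∈ H ⊔ K <;> simp [lam, hx, hx']
  have h := sum_eq_card_mul_sum_transversal hψ (fun x => |(lam H K x : ℝ)|)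
    fun x y hy => by rw [lam_mul_of_mem H K x hy]
  refine mul_left_cancel₀ hK.ne' (h.symm.trans ?_)
  simp only [habs]
  rw [sum_lam_mul H K (fun x => if x ∈ K then (1 : ℝ) else -1)]
  have hsum : ∑ y : ↥(H ⊔ K), (if (y : G) ∈ K then (1 : ℝ) else -1) =
      2 * Fintype.card K - Fintype.card ↥(H ⊔ K) := by
    have e (y : ↥(H ⊔ K)) : (if (y : G) ∈ K then (1 : ℝ) else -1) =
        2 * (if y ∈ K.subgroupOf (H ⊔ K) then 1 else 0) - 1 := by
      by_cases hy : (y : G) ∈ K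
      · simp [Subgroup.mem_subgroupOf, hy]; norm_num
      · simp [Subgroup.mem_subgroupOf, hy]
    have hc : (Finset.univ.filter fun y : ↥(H ⊔ K) => y ∈ K.subgroupOf (H ⊔ K)).card =
        Fintype.card K := by
      rw [← Fintype.card_subtype]
      exact Fintype.card_congr
        (Subgroup.subgroupOfEquivOfLe (le_sup_right : K ≤ H ⊔ K)).toEquiv
    simp only [e, Finset.sum_sub_distrib, ← Finset.mul_sum, Finset.sum_boole, hc]
    simp
  rw [hsum, ← hcard]
  simp
  ring

/-- `G` is transitive on the archimedean places, so this orbit sum does not depend on the place, and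
the product formula makes the total over all places vanish. -/
theorem sum_logAbs_smul [IsGalois ℚ l] (ŵ : InfinitePlace l) (α : FreeUnits l) :
    ∑ x : l ≃ₐ[ℚ] l, logAbs (x • ŵ) (Additive.ofMul α) = 0 := by
  have h (w : InfinitePlace l) : ∑ x : l ≃ₐ[ℚ] l, logAbs (x • w) (Additive.ofMul α) =
      ∑ x : l ≃ₐ[ℚ] l, logAbs (x • ŵ) (Additive.ofMul α) := by
    obtain ⟨g, rfl⟩ := InfinitePlace.exists_smul_eq_of_comap_eq (k := ℚ) (w := ŵ) (w' := w)
      (Subsingleton.elim _ _)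
    rw [← Equiv.sum_comp (Equiv.mulRight g)
      fun x : l ≃ₐ[ℚ] l => logAbs (x • ŵ) (Additive.ofMul α)]
    simp [mul_smul]
  have h0 : ∑ w : InfinitePlace l, ∑ x : l ≃ₐ[ℚ] l, logAbs (x • w) (Additive.ofMul α) = 0 := by
    rw [Finset.sum_comm]
    refine Finset.sum_eq_zero fun x _ => ?_
    rw [← sum_logAbs α]
    exact Equiv.sum_comp (MulAction.toPerm x)
      fun w : InfinitePlace l => logAbs w (Additive.ofMul α)
  simp only [h, Finset.sum_const, nsmul_eq_mul] at h0
  refine (mul_eq_zero.1 h0).resolve_left (Nat.cast_ne_zero.2 ?_)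
  exact Finset.card_ne_zero_of_mem (Finset.mem_univ ŵ)

variable {k : IntermediateField ℚ l} {ŵ : InfinitePlace l} {K H : Subgroup (l ≃ₐ[ℚ] l)}

theorem conj_Delta_mem_relUnits [IsGalois k l] [k.fixingSubgroup.Normal]
    {N : ℕ} {ψ : Fin N → (l ≃ₐ[ℚ] l)} (hψ : IsLeftTransversal K ψ) {α : FreeUnits l}
    (hα : ∀ x ∈ K, ∀ w : InfinitePlace l,
      logAbs (x • w) (Additive.ofMul α) = logAbs w (Additive.ofMul α)) (g : l ≃ₐ[ℚ] l) :
    conj g (Delta ψ α (lam k.fixingSubgroup K)) ∈ relUnits k := by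
  set H := k.fixingSubgroup with hH
  have := Fintype.ofFinite K
  have := Fintype.ofFinite H
  have := Fintype.ofFinite ↥(H ⊔ K)
  have hK : (0 : ℝ) < Fintype.card K := by exact_mod_cast Fintype.card_pos
  set f : InfinitePlace l → ℝ := fun w => logAbs w (Additive.ofMul α) with hf
  -- Write `m = y * z` with `y ∈ K`, `z ∈ H`: `α` does not see `y`, and `z` is absorbed by
  -- reindexing `H`.
  have hmul (m : ↥(H ⊔ K)) (w : InfinitePlace l) :
      ∑ h : H, f ((m : l ≃ₐ[ℚ] l) • (h : l ≃ₐ[ℚ] l) • w) =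
        ∑ h : H, f ((h : l ≃ₐ[ℚ] l) • w) := by
    obtain ⟨y, hy, z, hz, hyz⟩ := Subgroup.mem_sup_of_normal_right.1 (sup_comm H K ▸ m.2 :
      (m : l ≃ₐ[ℚ] l) ∈ K ⊔ H)
    rw [← Equiv.sum_comp (Equiv.mulLeft (⟨z, hz⟩ : H)) fun h : H => f ((h : l ≃ₐ[ℚ] l) • w)]
    refine Finset.sum_congr rfl fun h _ => ?_
    rw [← hyz, mul_smul, hf]
    simp only [hα y hy]
    simp [mul_smul]
  have hD (w : InfinitePlace l) : ∑ h : H, logAbs ((h : l ≃ₐ[ℚ] l) • w)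
      (Additive.ofMul (Delta ψ α (lam H K))) = 0 := by
    refine (mul_eq_zero.1 ?_).resolve_left hK.ne'
    simp only [Finset.mul_sum, card_mul_logAbs_Delta hψ hα, Finset.sum_sub_distrib]
    rw [Finset.sum_comm, ← Equiv.sum_comp (Equiv.inv ↥(H ⊔ K))]
    have e (m : ↥(H ⊔ K)) : ∑ h : H, logAbs
        (((Equiv.inv ↥(H ⊔ K) m : ↥(H ⊔ K)) : l ≃ₐ[ℚ] l)⁻¹ • (h : l ≃ₐ[ℚ] l) • w)
          (Additive.ofMul α) = ∑ h : H, f ((h : l ≃ₐ[ℚ] l) • w) := by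
      simpa using hmul m w
    simp only [e]
    simp [hf, Finset.mul_sum]
  refine mem_relUnits_of_sum_eq_zero k fun w => ?_
  -- Normality of `H` lets `g⁻¹` pass through the sum.
  rw [← hD (g⁻¹ • w), ← Equiv.sum_comp (MulAut.conjNormal g : H ≃* H).toEquiv]
  refine Finset.sum_congr rfl fun h _ => ?_
  rw [logAbs_conj]
  simp [smul_smul, mul_assoc]

theorem linearIndependent_conj_Delta [IsGalois ℚ l]
    (hK : K = MulAction.stabilizer (l ≃ₐ[ℚ] l) ŵ) {N I J : ℕ}
    {ψ : Fin N → (l ≃ₐ[ℚ] l)} (hψ : IsLeftTransversal K ψ)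
    {τ : Fin I → (l ≃ₐ[ℚ] l)} (hτ : IsLeftTransversal (H ⊔ K) τ)
    {σ : Fin J → ↥(H ⊔ K)} (hσ : IsLeftTransversal (K.subgroupOf (H ⊔ K)) σ)
    {𝒥 : Fin I → Finset (Fin J)} (h𝒥 : ∀ i, (𝒥 i).card = J - 1) {α : FreeUnits l}
    (hα : ∀ x ∈ K, ∀ w : InfinitePlace l,
      logAbs (x • w) (Additive.ofMul α) = logAbs w (Additive.ofMul α))
    (hneg : IsSpecialMinkowskiUnit ŵ α) :
    LinearIndependent ℤ (fun p : Σ i, 𝒥 i =>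
      Additive.ofMul (conj (τ p.1 * (σ p.2 : l ≃ₐ[ℚ] l)) (Delta ψ α (lam H K)))) := by
  classical
  have := Fintype.ofFinite K
  have := Fintype.ofFinite ↥(H ⊔ K)
  have hstab (x : l ≃ₐ[ℚ] l) : x ∈ K ↔ x • ŵ = ŵ := by rw [hK]; rfl
  set D := Delta ψ α (lam H K) with hDdef
  rw [Fintype.linearIndependent_iff]
  intro c hc
  -- Extending the coefficients by zero to all of `G ⧸ K` is what later forces `C = 0` on each coset
  -- of `HK`.
  let c' : Fin I × Fin J → ℝ := fun p =>
    if h : p.2 ∈ 𝒥 p.1 then (c ⟨p.1, p.2, h⟩ : ℝ) else 0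
  have hT := IsLeftTransversal.mul le_sup_right hτ hσ
  let e := Equiv.ofBijective _ hT
  let C : (l ≃ₐ[ℚ] l) → ℝ := fun x => c' (e.symm (x : (l ≃ₐ[ℚ] l) ⧸ K))
  have hCT (p : Fin I × Fin J) : C (τ p.1 * (σ p.2 : l ≃ₐ[ℚ] l)) = c' p :=
    congrArg c' (e.symm_apply_apply p)
  have hCK : ∀ x, ∀ y ∈ K, C (x * y) = C x := fun x y hy => by
    have : ((x * y : l ≃ₐ[ℚ] l) : (l ≃ₐ[ℚ] l) ⧸ K) = x := QuotientGroup.mk_mul_of_mem x hy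
    simp only [C, this]
  let a : (l ≃ₐ[ℚ] l) → ℝ := fun x => logAbs (x • ŵ) (Additive.ofMul α)
  have haneg : ∀ x ∉ K, a x < 0 := fun x hx => hneg _ fun h => hx ((hstab x).2 h)
  have hasum : ∑ x, a x = 0 := sum_logAbs_smul ŵ α
  have hlog (g : l ≃ₐ[ℚ] l) : ∑ p, c' p *
      logAbs ((τ p.1 * (σ p.2 : l ≃ₐ[ℚ] l))⁻¹ • g • ŵ) (Additive.ofMul D) = 0 := by
    have h := congrArg (logAbs (g • ŵ)) hc
    rw [map_sum, map_zero, Fintype.sum_sigma] at h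
    rw [← h, Fintype.sum_prod_type]
    refine Finset.sum_congr rfl fun i _ => ?_
    simp only [map_zsmul, zsmul_eq_mul, logAbs_conj, c', dite_mul, zero_mul]
    rw [← Finset.sum_subset (Finset.subset_univ (𝒥 i)) fun j _ hj => dif_neg hj,
      ← Finset.sum_coe_sort]
    exact Finset.sum_congr rfl fun j _ => dif_pos j.2
  have hDK : ∀ x ∈ K, ∀ w : InfinitePlace l,
      logAbs (x • w) (Additive.ofMul D) = logAbs w (Additive.ofMul D) := fun x hx w => by
    refine mul_left_cancel₀ (Nat.cast_ne_zero.2 Fintype.card_ne_zero :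
      (Fintype.card K : ℝ) ≠ 0) ?_
    rw [card_mul_logAbs_Delta hψ hα, card_mul_logAbs_Delta hψ hα, hα x hx]
    congr 1
    let y : ↥(H ⊔ K) := ⟨x, Subgroup.mem_sup_right hx⟩
    rw [← Equiv.sum_comp (Equiv.mulLeft y)]
    simp [y, smul_smul]
  have hinv := mul_right_invariant_of_sum_eq_zero (le_sup_right : K ≤ H ⊔ K) haneg hasum hCK
    fun g => by
      have h1 : ∑ x, C x * logAbs (x⁻¹ • g • ŵ) (Additive.ofMul D) = 0 := by
        rw [sum_eq_card_mul_sum_transversal hT]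
        · simp only [hCT, hlog, mul_zero]
        · intro x y hy
          rw [hCK x y hy, mul_inv_rev, mul_smul, hDK _ (K.inv_mem hy)]
      rw [← mul_zero (Fintype.card K : ℝ), ← h1, Finset.mul_sum]
      refine Finset.sum_congr rfl fun x _ => ?_
      rw [mul_left_comm, card_mul_logAbs_Delta hψ hα]
      simp only [a, mul_smul]
  rintro ⟨i, j, hj⟩
  -- The index `j` shows `J > 0`, so the truncated `J - 1` is less than `J`.
  obtain ⟨j', hj'⟩ : ∃ j', j' ∉ 𝒥 i := by
    by_contra! h
    have h1 : 𝒥 i = Finset.univ := Finset.eq_univ_iff_forall.2 h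
    have h2 := h𝒥 i
    rw [h1, Finset.card_univ, Fintype.card_fin] at h2
    have := j.pos
    omega
  have h1 : C (τ i * (σ j : l ≃ₐ[ℚ] l)) = C (τ i) := hinv _ (σ j).2
  have h2 : C (τ i * (σ j' : l ≃ₐ[ℚ] l)) = C (τ i) := hinv _ (σ j').2
  rw [hCT (i, j)] at h1
  rw [hCT (i, j')] at h2
  have h3 := h1.trans h2.symm
  simpa [c', hj, hj'] using h3

theorem height_Delta_lam_le [IsGalois ℚ l] [k.fixingSubgroup.Normal]
    {N : ℕ} {ψ : Fin N → (l ≃ₐ[ℚ] l)} (hψ : IsLeftTransversal K ψ) (α : FreeUnits l) :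
    height (Delta ψ α (lam k.fixingSubgroup K)) ≤
      2 * ((Module.finrank k l : ℝ) - 1) * height α := by
  refine (height_Delta_le ψ α _).trans ?_
  rw [sum_abs_lam_transversal _ K hψ]
  have h : (K.relIndex (k.fixingSubgroup ⊔ K) : ℝ) ≤ Module.finrank k l := by
    rw [← IsGalois.card_fixingSubgroup_eq_finrank k]
    exact_mod_cast relIndex_sup_le_card _ K
  exact mul_le_mul_of_nonneg_right (by linarith) (height_nonneg α)

end
end RelativeUnits

/-! ### The totally real and totally complex cases -/

open RelativeUnits in
theorem theorem9p1 {l : Type*} [Field l] [NumberField l] [IsGalois ℚ l]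
    (k : IntermediateField ℚ l) [IsGalois ℚ k]
    (hrk : 1 ≤ NumberField.Units.rank k)
    (hrl : NumberField.Units.rank k < NumberField.Units.rank l)
    (ŵ : InfinitePlace l)
    -- `K` is the stabiliser of `ŵ` in `G = Aut(l/ℚ)`, and `H = Aut(l/k)`
    (K H : Subgroup (l ≃ₐ[ℚ] l))
    (hK : K = MulAction.stabilizer (l ≃ₐ[ℚ] l) ŵ) (hH : H = k.fixingSubgroup)
    {N I J : ℕ}
    -- the transversal for the left cosets of `K` in `G` that enters the definition of `Δ`
    (ψ : Fin N → (l ≃ₐ[ℚ] l)) (hψ : IsLeftTransversal K ψ)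
    -- transversals for the left cosets of `HK` in `G` and of `K` in `HK`
    (τ : Fin I → (l ≃ₐ[ℚ] l)) (hτ : IsLeftTransversal (H ⊔ K) τ)
    (σ : Fin J → ↥(H ⊔ K)) (hσ : IsLeftTransversal (K.subgroupOf (H ⊔ K)) σ)
    (𝒥 : Fin I → Finset (Fin J)) (h𝒥 : ∀ i, (𝒥 i).card = J - 1)
    (β : FreeUnits l) (hβ : IsSpecialMinkowskiUnit ŵ β) :
    (IsTotallyReal l →
      (∀ i, ∀ j ∈ 𝒥 i, conj (τ i * (σ j : l ≃ₐ[ℚ] l)) (Delta ψ β (lam H K)) ∈ relUnits k) ∧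
      LinearIndependent ℤ (fun p : Σ i, 𝒥 i =>
        Additive.ofMul (conj (τ p.1 * (σ p.2 : l ≃ₐ[ℚ] l)) (Delta ψ β (lam H K)))) ∧
      height (Delta ψ β (lam H K)) ≤ 2 * ((Module.finrank k l : ℝ) - 1) * height β) ∧
    (IsTotallyComplex l → ∀ ρ : l ≃ₐ[ℚ] l, (K : Set (l ≃ₐ[ℚ] l)) = {1, ρ} →
      (∀ i, ∀ j ∈ 𝒥 i,
        conj (τ i * (σ j : l ≃ₐ[ℚ] l)) (Delta ψ (β * conj ρ β) (lam H K)) ∈ relUnits k) ∧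
      LinearIndependent ℤ (fun p : Σ i, 𝒥 i =>
        Additive.ofMul (conj (τ p.1 * (σ p.2 : l ≃ₐ[ℚ] l)) (Delta ψ (β * conj ρ β) (lam H K)))) ∧
      height (Delta ψ (β * conj ρ β) (lam H K)) ≤
        4 * ((Module.finrank k l : ℝ) - 1) * height β) := by
  subst hH
  -- Two `ℚ`-algebra structures on `k` occur; they agree because such a structure is unique.
  have : @IsGalois ℚ _ k _ k.algebra' := by
    convert ‹IsGalois ℚ k›
    exact Subsingleton.elim _ _
  have : k.fixingSubgroup.Normal := IsGalois.fixingSubgroup_normal_of_isGalois k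
  have main (α : FreeUnits l) (hα : ∀ x ∈ K, ∀ w : InfinitePlace l,
      logAbs (x • w) (Additive.ofMul α) = logAbs w (Additive.ofMul α))
      (hneg : IsSpecialMinkowskiUnit ŵ α) :=
    And.intro (fun i => fun j (_ : j ∈ 𝒥 i) =>
      conj_Delta_mem_relUnits (k := k) hψ hα (τ i * (σ j : l ≃ₐ[ℚ] l)))
      (And.intro (linearIndependent_conj_Delta hK hψ hτ hσ h𝒥 hα hneg)
        (height_Delta_lam_le (k := k) hψ α))
  refine ⟨fun hreal => main β (fun x hx w => ?_) hβ, fun _ ρ hρ => ?_⟩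
  · have hbot : K = ⊥ := by
      rw [hK]
      exact (InfinitePlace.IsReal.isUnramified ℚ (hreal.isReal ŵ)).stabilizer_eq_bot
    rw [hbot, Subgroup.mem_bot] at hx
    rw [hx, one_smul]
  · have hmem (x : l ≃ₐ[ℚ] l) : x ∈ K ↔ x = 1 ∨ x = ρ := by
      rw [← SetLike.mem_coe, hρ]; rfl
    have hρK : ρ ∈ K := (hmem ρ).2 (Or.inr rfl)
    have hinv : ρ⁻¹ = ρ := by
      rcases (hmem ρ⁻¹).1 (K.inv_mem hρK) with h | h
      · rw [h, ← inv_eq_one.1 h]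
      · exact h
    have hρ2 : ρ * ρ = 1 := by
      nth_rewrite 1 [← hinv]
      exact inv_mul_cancel ρ
    obtain ⟨h1, h2, h3⟩ := main (β * conj ρ β) (fun x hx w => by
      simp only [logAbs_mul, logAbs_conj, hinv]
      rcases (hmem x).1 hx with rfl | rfl
      · simp
      · rw [smul_smul, hρ2, one_smul, add_comm]) (fun w hw => by
      rw [← logAbs_ofMul, logAbs_mul, logAbs_conj]
      -- As `ρ` fixes `ŵ`, `ρ⁻¹ • w = ŵ` would force `w = ŵ`; so both summands are negative.
      refine add_neg (hβ w hw) (hβ _ fun h => hw ?_)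
      rw [hK] at hρK
      rw [← MulAction.mem_stabilizer_iff.1 hρK, ← h, smul_inv_smul])
    refine ⟨h1, h2, h3.trans ?_⟩
    have h4 : height (β * conj ρ β) ≤ 2 * height β := by
      have := height_mul_le β (conj ρ β)
      rw [height_conj] at this
      linarith
    have h5 : (1 : ℝ) ≤ Module.finrank k l := by
      exact_mod_cast Module.finrank_pos (R := k) (M := l)
    nlinarith
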